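/- **Setting.** Fix $N\ge 1$. A *weight matrix* on an interval $I\subseteq\mathbb{R}$ of positive length is a function $W:I\to \operatorname{Mat}_N(\mathbb{C})$ that is positive definite almost everywhere on $I$ and such that the integrals $\int_I x^nW(x)\,dx$ converge absolutely (entrywise) for all $n\ge 0$. Put $\langle P,Q\rangle_W=\int_I P(x)W(x)Q(x)^*\,dx$ for $P,Q\in\operatorname{Mat}_N(\mathbb{C})[x]$, and let $(P_n)_{n\ge0}$ be the monic orthogonal polynomials of $W$: $P_n$ is monic of degree $n$, and $\langle P_m,P_n\rangle_W=0$ for $m\neq n$. A differential operator $D=\sum_{j=0}^s \frac{d^j}{dx^j}F_j(x)$ with $F_j\in\operatorname{Mat}_N(\mathbb{C})[x]$ acts on the right by $P\cdot D=\sum_j P^{(j)}F_j$, and operators are multiplied so that $P\cdot(D_1D_2)=(P\cdot D_1)\cdot D_2$. Let $\mathcal{D}(W)$ be the set of such operators $D$ for which there are constant matrices $\Lambda_n$ with $P_n\cdot D=\Lambda_nP_n$ for all $n\ge 0$. An operator $\mathcal{V}$ is *degree-preserving* if $\deg(P\cdot\mathcal{V})=\deg P$ for every $P\in\operatorname{Mat}_N(\mathbb{C})[x]$.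 A weight matrix $\tilde W$ with monic orthogonal polynomials $(\tilde P_n)$ is a *Darboux transformation* of a weight matrix $W$ with monic orthogonal polynomials $(P_n)$ if some $D\in\mathcal{D}(W)$ factors as $D=\mathcal{V}\mathcal{N}$ with $\mathcal{V},\mathcal{N}$ degree-preserving differential operators with matrix polynomial coefficients, and there are matrices $A_n\in\operatorname{Mat}_N(\mathbb{C})$ with $P_n\cdot\mathcal{V}=A_n\tilde P_n$ for all $n\ge 0$. **Theorem.** Let $Z:\mathbb{R}\to\operatorname{Mat}_N(\mathbb{C})$ be such that $W(x)=e^{-x^2}Z(x)$ is a weight matrix on $\mathbb{R}$ with $W(x)=W(-x)$ for all $x$. Suppose that $W$ is a Darboux transformation of the weight $e^{-x^2}I$ on $\mathbb{R}$. Then, on $(0,\infty)$, the functions $$V(y)=y^{-1/2}e^{-y}Z(\sqrt y)\qquad\text{and}\qquad U(y)=y^{1/2}e^{-y}Z(\sqrt y)$$ are weight matrices, and $V$ is a Darboux transformation of $y^{-1/2}e^{-y}I$, and $U$ is a Darboux transformation of $y^{1/2}e^{-y}I$. -/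

import Mathlib

open scoped ComplexOrder Polynomial

namespace MVOP

/-- Complex `N × N` matrices. -/
abbrev Mat (N : ℕ) : Type := Matrix (Fin N) (Fin N) ℂ

/-- The value `P(x) = ∑ xᵏ Pₖ` of a matrix polynomial at a real point. -/
noncomputable def evalAt {N : ℕ} (P : (Mat N)[X]) (x : ℝ) : Mat N :=
  P.sum fun k a => (x : ℂ) ^ k • a

/-- `W` is a weight matrix on the interval `I` (nondegenerate): positive definite almost
everywhere on `I`, with all moments `∫ xⁿ W(x) dx` convergent (the case `n = 0` is the
integrability of `W`). Values of `W` outside `I` are irrelevant. -/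
structure IsWeight {N : ℕ} (I : Set ℝ) (W : ℝ → Mat N) : Prop where
  ordConnected : I.OrdConnected
  interior_nonempty : (interior I).Nonempty
  posDef : ∀ᵐ x ∂(MeasureTheory.volume.restrict I), (W x).PosDef
  moments : ∀ (n : ℕ) (i j : Fin N),
    MeasureTheory.IntegrableOn (fun x : ℝ => (x : ℂ) ^ n * W x i j) I

/-- The matrix-valued form `⟨P, Q⟩_W = ∫_I P(x) W(x) Q(x)^* dx`, integrated entrywise. -/
noncomputable def form {N : ℕ} (I : Set ℝ) (W : ℝ → Mat N) (P Q : (Mat N)[X]) : Mat N :=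
  Matrix.of fun i j => ∫ x in I, (evalAt P x * W x * (evalAt Q x).conjTranspose) i j

/-- `P` is the sequence of monic orthogonal matrix polynomials of `W`, with `deg Pₙ = n`.
(For a weight matrix there is exactly one such sequence.) -/
structure IsMonicOPS {N : ℕ} (I : Set ℝ) (W : ℝ → Mat N) (P : ℕ → (Mat N)[X]) : Prop where
  monic : ∀ n, (P n).Monic
  degree_eq : ∀ n, (P n).degree = n
  orthogonal : ∀ m n, m ≠ n → form I W (P m) (P n) = 0

/-- Matrix differential operators `D = ∑ⱼ (d/dx)ʲ Fⱼ(x)` with matrix polynomial coefficients;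
the operator is stored as its finitely supported family of coefficients `j ↦ Fⱼ`. -/
abbrev DiffOp (N : ℕ) : Type := ℕ →₀ (Mat N)[X]

namespace DiffOp

/-- The right action `P · D = ∑ⱼ P⁽ʲ⁾ Fⱼ`. -/
noncomputable def act {N : ℕ} (D : DiffOp N) (P : (Mat N)[X]) : (Mat N)[X] :=
  D.sum fun j F => (Polynomial.derivative^[j] P) * F

/-- The product `D₁ D₂` of operators acting on the right (first `D₁`, then `D₂`), by Leibniz:
`(d/dx)ⁱ F (d/dx)ʲ G = ∑ₖ (j choose k) (d/dx)ⁱ⁺ʲ⁻ᵏ F⁽ᵏ⁾ G`. See `act_comp`. -/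
noncomputable def comp {N : ℕ} (D₁ D₂ : DiffOp N) : DiffOp N :=
  D₁.sum fun i F => D₂.sum fun j G => ∑ k ∈ Finset.range (j + 1),
    Finsupp.single (i + (j - k)) (j.choose k • ((Polynomial.derivative^[k] F) * G))

theorem act_single {N : ℕ} (j : ℕ) (F P : (Mat N)[X]) :
    act (Finsupp.single j F) P = (Polynomial.derivative^[j] P) * F := by
  simp [act]

theorem act_zero {N : ℕ} (P : (Mat N)[X]) : act (0 : DiffOp N) P = 0 := by
  simp [act]

theorem act_add {N : ℕ} (D E : DiffOp N) (P : (Mat N)[X]) :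
    act (D + E) P = act D P + act E P := by
  unfold act
  exact Finsupp.sum_add_index' (by simp) (by intros; rw [mul_add])

theorem act_finset_sum {N : ℕ} {ι : Type*} (s : Finset ι) (D : ι → DiffOp N)
    (P : (Mat N)[X]) : act (∑ i ∈ s, D i) P = ∑ i ∈ s, act (D i) P := by
  classical
  induction s using Finset.induction_on with
  | empty => simp [act_zero]
  | insert a s ha ih => rw [Finset.sum_insert ha, Finset.sum_insert ha, act_add, ih]

/-- The product of operators is composition of the right actions. -/
theorem act_comp {N : ℕ} (D₁ D₂ : DiffOp N) (P : (Mat N)[X]) :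
    act (comp D₁ D₂) P = act D₂ (act D₁ P) := by
  have key : ∀ (i j : ℕ) (F G : (Mat N)[X]),
      (∑ k ∈ Finset.range (j + 1), act (Finsupp.single (i + (j - k))
        (j.choose k • ((Polynomial.derivative^[k] F) * G))) P)
      = (Polynomial.derivative^[j] ((Polynomial.derivative^[i] P) * F)) * G := by
    intro i j F G
    rw [Polynomial.iterate_derivative_mul, Finset.sum_mul]
    refine Finset.sum_congr rfl fun k _ => ?_
    rw [act_single, mul_smul_comm, smul_mul_assoc, mul_assoc, ← Function.iterate_add_apply,
      add_comm i]
  unfold comp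
  simp only [Finsupp.sum, act_finset_sum, key]
  rw [Finset.sum_comm]
  simp only [act, Finsupp.sum, Polynomial.iterate_derivative_sum, Finset.sum_mul]

/-- `V` is degree-preserving: `deg (P · V) = deg P` for every matrix polynomial `P`. -/
def DegreePreserving {N : ℕ} (V : DiffOp N) : Prop :=
  ∀ P : (Mat N)[X], (act V P).degree = P.degree

end DiffOp

/-- The algebra `𝒟(W)` of the weight `W` on `I`: the operators `D` such that the monic orthogonal
polynomials `Pₙ` of `W` satisfy `Pₙ · D = Λₙ Pₙ` for all `n`, with constant matrices `Λₙ`. -/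
def diffAlgebra {N : ℕ} (I : Set ℝ) (W : ℝ → Mat N) : Set (DiffOp N) :=
  {D | ∃ P : ℕ → (Mat N)[X], IsMonicOPS I W P ∧
    ∃ Λ : ℕ → Mat N, ∀ n, D.act (P n) = Polynomial.C (Λ n) * P n}

/-- The weight matrix `W'` on `J` is a Darboux transformation of the weight matrix `W` on `I`:
some `D ∈ 𝒟(W)` factors as `D = S T` with `S`, `T` degree-preserving, and
`Pₙ · S = Aₙ P'ₙ` for all `n`, where `P`, `P'` are the monic orthogonal polynomials of
`W`, `W'` and the `Aₙ` are constant matrices. -/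
def IsDarbouxTransformation {N : ℕ} (J : Set ℝ) (W' : ℝ → Mat N) (I : Set ℝ) (W : ℝ → Mat N) :
    Prop :=
  IsWeight I W ∧ IsWeight J W' ∧
  ∃ P P' : ℕ → (Mat N)[X], IsMonicOPS I W P ∧ IsMonicOPS J W' P' ∧
  ∃ D ∈ diffAlgebra I W, ∃ S T : DiffOp N, D = S.comp T ∧
    S.DegreePreserving ∧ T.DegreePreserving ∧
    ∃ A : ℕ → Mat N, ∀ n, S.act (P n) = Polynomial.C (A n) * P' n

/-- The Hermite-type weight `e^{-x²} Z(x)` (on the real line). -/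
noncomputable def hermiteWeight {N : ℕ} (Z : ℝ → Mat N) (x : ℝ) : Mat N :=
  ((Real.exp (-x ^ 2) : ℝ) : ℂ) • Z x

/-- The Laguerre-type weight `y^α e^{-y} Z(y)` (on the half-line `y > 0`). -/
noncomputable def laguerreWeight {N : ℕ} (α : ℝ) (Z : ℝ → Mat N) (y : ℝ) : Mat N :=
  ((y ^ α * Real.exp (-y) : ℝ) : ℂ) • Z y

end MVOP

/-! The mechanism is the quadratic substitution `y = x²`, which splits Hermite into the two Laguerre
cases. It works for any Darboux transformation between even weights on the line
(`IsDarbouxTransformation.fold`); the case `ε = 0` gives `V` and `ε = 1` gives `U`.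

Since the weights are even, their monic orthogonal polynomials have parity `(-1)ⁿ`
(`IsMonicOPS.mem_parityPoly`), so `P_{2n+ε}(x) = x^ε p_n(x²)`. The substitution is an isometry for
the forms (`IsFoldedWeight.form_eq`), hence the `p_n` are the monic orthogonal polynomials of the
folded weight.

The operators descend as well. `D` and `S` preserve parity because they send `P_n` to constant
multiples of `P_n` and `P'_n`; `T` does because `A_n` is invertible and `A_n (P'_n · T) = P_n · D`.
On polynomials `x^ε p(x²)` a parity-preserving operator acts as a differential operator in `y` with
polynomial coefficients (`foldable_act`, `ParityPreserving.exists_descent`). Factorization, degree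
preservation and the relations for `D` and `S` then carry over. -/

namespace MVOP

open Polynomial MeasureTheory

variable {N : ℕ}

/-! ### Even and odd parts of matrix polynomials -/

/-- The embedding `p(y) ↦ x^ε p(x²)`. -/
noncomputable def unfoldPoly (ε : ℕ) : (Mat N)[X] →ₗ[Mat N] (Mat N)[X] :=
  Polynomial.lsum fun k => Polynomial.monomial (2 * k + ε)

/-- The map `∑ aₖ xᵏ ↦ ∑ a_{2k+ε} yᵏ`, a left inverse of `unfoldPoly ε` for `ε < 2`. -/
noncomputable def foldPoly (ε : ℕ) : (Mat N)[X] →ₗ[Mat N] (Mat N)[X] :=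
  Polynomial.lsum fun k => if k % 2 = ε then Polynomial.monomial (k / 2) else 0

theorem unfoldPoly_monomial (ε k : ℕ) (a : Mat N) :
    unfoldPoly ε (monomial k a) = monomial (2 * k + ε) a := by
  simp [unfoldPoly, Polynomial.lsum_apply]

theorem foldPoly_monomial (ε k : ℕ) (a : Mat N) :
    foldPoly ε (monomial k a) = if k % 2 = ε then monomial (k / 2) a else 0 := by
  rw [foldPoly, Polynomial.lsum_apply, Polynomial.sum_monomial_index _ _ (by simp)]
  split_ifs <;> simp

theorem coeff_foldPoly {ε : ℕ} (hε : ε < 2) (p : (Mat N)[X]) (k : ℕ) :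
    (foldPoly ε p).coeff k = p.coeff (2 * k + ε) := by
  induction p using Polynomial.induction_on' with
  | add p q hp hq => simp [hp, hq]
  | monomial n a =>
    rw [foldPoly_monomial]
    split_ifs with h
    · simp only [coeff_monomial]
      congr 1
      apply propext
      omega
    · rw [coeff_zero, coeff_monomial, if_neg (by omega)]

theorem coeff_unfoldPoly {ε : ℕ} (hε : ε < 2) (p : (Mat N)[X]) (m : ℕ) :
    (unfoldPoly ε p).coeff m = if m % 2 = ε then p.coeff (m / 2) else 0 := by
  induction p using Polynomial.induction_on' with
  | add p q hp hq => rw [map_add, coeff_add, hp, hq]; split_ifs <;> simp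
  | monomial n a =>
    rw [unfoldPoly_monomial]
    simp only [coeff_monomial]
    split_ifs <;> first | rfl | omega

theorem foldPoly_unfoldPoly {ε : ℕ} (hε : ε < 2) (p : (Mat N)[X]) :
    foldPoly ε (unfoldPoly ε p) = p := by
  ext1 k
  rw [coeff_foldPoly hε, coeff_unfoldPoly hε, if_pos (by omega)]
  congr 1
  omega

theorem unfoldPoly_fold_add (p : (Mat N)[X]) :
    unfoldPoly 0 (foldPoly 0 p) + unfoldPoly 1 (foldPoly 1 p) = p := by
  ext1 m
  rw [coeff_add, coeff_unfoldPoly (by norm_num), coeff_unfoldPoly (by norm_num),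
    coeff_foldPoly (by norm_num), coeff_foldPoly (by norm_num)]
  rcases Nat.mod_two_eq_zero_or_one m with h | h
  · rw [if_pos h, if_neg (by omega), add_zero]
    congr 1
    omega
  · rw [if_pos h, if_neg (by omega), zero_add]
    congr 1
    omega

/-- Strict bounds treat the zero polynomial uniformly, where an equality of degrees would need a
separate case. -/
theorem degree_unfoldPoly_lt_iff {ε : ℕ} (hε : ε < 2) (p : (Mat N)[X]) (n : ℕ) :
    (unfoldPoly ε p).degree < ((2 * n + ε : ℕ) : WithBot ℕ) ↔ p.degree < n := by
  rw [degree_lt_iff_coeff_zero, degree_lt_iff_coeff_zero]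
  constructor
  · intro h m hm
    have := h (2 * m + ε) (by omega)
    rwa [coeff_unfoldPoly hε, if_pos (by omega), show (2 * m + ε) / 2 = m by omega] at this
  · intro h m hm
    rw [coeff_unfoldPoly hε]
    split_ifs
    · exact h _ (by omega)
    · rfl

theorem degree_eq_of_degree_unfoldPoly_eq {ε : ℕ} (hε : ε < 2) {p q : (Mat N)[X]}
    (h : (unfoldPoly ε p).degree = (unfoldPoly ε q).degree) : p.degree = q.degree := by
  have key : ∀ n : ℕ, p.degree < n ↔ q.degree < n := fun n => by
    rw [← degree_unfoldPoly_lt_iff hε, h, degree_unfoldPoly_lt_iff hε]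
  have le : ∀ {p q : (Mat N)[X]}, (∀ n : ℕ, p.degree < n ↔ q.degree < n) →
      p.degree ≤ q.degree := by
    intro p q key
    refine degree_le_iff_coeff_zero _ _ |>.2 fun m hm => ?_
    exact coeff_eq_zero_of_degree_lt ((key m).2 hm)
  exact le_antisymm (le key) (le fun n => (key n).symm)

/-- The matrix polynomials `p` with `p(-x) = (-1)ⁿ p(x)`. -/
noncomputable def parityPoly (N n : ℕ) : Submodule (Mat N) (Mat N)[X] where
  carrier := {p | ∀ m, Odd (m + n) → p.coeff m = 0}
  add_mem' hp hq m hm := by rw [coeff_add, hp m hm, hq m hm, add_zero]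
  zero_mem' m _ := coeff_zero m
  smul_mem' a p hp m hm := by rw [coeff_smul, hp m hm, smul_zero]

theorem mem_parityPoly {n : ℕ} {p : (Mat N)[X]} :
    p ∈ parityPoly N n ↔ ∀ m, Odd (m + n) → p.coeff m = 0 := Iff.rfl

theorem C_mul_mem_parityPoly {n : ℕ} {p : (Mat N)[X]} (a : Mat N) (hp : p ∈ parityPoly N n) :
    C a * p ∈ parityPoly N n := by
  rw [← smul_eq_C_mul]
  exact Submodule.smul_mem _ a hp

theorem parityPoly_congr {m n : ℕ} (h : Even (m + n)) : parityPoly N m = parityPoly N n := by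
  ext p
  simp only [mem_parityPoly]
  refine forall_congr' fun k => ?_
  have : Odd (k + m) ↔ Odd (k + n) := by
    rw [Nat.even_iff] at h
    rw [Nat.odd_iff, Nat.odd_iff]
    omega
  rw [this]

theorem unfoldPoly_mem_parityPoly {ε : ℕ} (hε : ε < 2) (p : (Mat N)[X]) :
    unfoldPoly ε p ∈ parityPoly N ε := by
  intro m hm
  rw [Nat.odd_iff] at hm
  rw [coeff_unfoldPoly hε, if_neg (by omega)]

theorem unfoldPoly_foldPoly {ε : ℕ} (hε : ε < 2) {p : (Mat N)[X]} (hp : p ∈ parityPoly N ε) :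
    unfoldPoly ε (foldPoly ε p) = p := by
  ext1 m
  rw [coeff_unfoldPoly hε, coeff_foldPoly hε]
  split_ifs with h
  · congr 1
    omega
  · refine (hp m ?_).symm
    rw [Nat.odd_iff]
    omega

/-- A polynomial is the sum of its parts of parity `n` and `n + 1`. -/
theorem exists_parity_decomposition (n : ℕ) (p : (Mat N)[X]) :
    ∃ q ∈ parityPoly N n, ∃ r ∈ parityPoly N (n + 1), q + r = p := by
  have h0 := unfoldPoly_mem_parityPoly (ε := 0) (by norm_num) (foldPoly 0 p)
  have h1 := unfoldPoly_mem_parityPoly (ε := 1) (by norm_num) (foldPoly 1 p)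
  rcases Nat.even_or_odd n with hn | hn
  · refine ⟨_, ?_, _, ?_, unfoldPoly_fold_add p⟩
    · rwa [parityPoly_congr (m := n) (n := 0) (by simpa using hn)]
    · rwa [parityPoly_congr (m := n + 1) (n := 1) (by grind)]
  · refine ⟨_, ?_, _, ?_, (add_comm _ _).trans (unfoldPoly_fold_add p)⟩
    · rwa [parityPoly_congr (m := n) (n := 1) (by grind)]
    · rwa [parityPoly_congr (m := n + 1) (n := 0) (by grind)]

/-! ### Differential operators in the variable `y = x²` -/

namespace DiffOp

theorem act_polynomial_add (D : DiffOp N) (p q : (Mat N)[X]) :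
    act D (p + q) = act D p + act D q := by
  simp only [act, Finsupp.sum, iterate_map_add derivative, add_mul, Finset.sum_add_distrib]

theorem act_C_mul (D : DiffOp N) (a : Mat N) (p : (Mat N)[X]) :
    act D (C a * p) = C a * act D p := by
  have h : ∀ j, derivative^[j] (C a * p) = C a * derivative^[j] p := by
    intro j
    rw [← smul_eq_C_mul, Polynomial.iterate_derivative_smul, smul_eq_C_mul]
  simp only [act, Finsupp.sum, h, Finset.mul_sum, mul_assoc]

theorem act_polynomial_zero (D : DiffOp N) : act D 0 = 0 := by
  simp [act]

/-- The differential operators all of whose components with respect to the decomposition into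
even and odd polynomials are differential operators in the variable `y = x²`. -/
def Foldable (T : (Mat N)[X] → (Mat N)[X]) : Prop :=
  ∀ ε < 2, ∀ δ < 2, ∃ D : DiffOp N, ∀ p, act D p = foldPoly δ (T (unfoldPoly ε p))

theorem foldable_add {S T : (Mat N)[X] → (Mat N)[X]} (hS : Foldable S) (hT : Foldable T) :
    Foldable fun p => S p + T p := by
  intro ε hε δ hδ
  obtain ⟨A, hA⟩ := hS ε hε δ hδ
  obtain ⟨B, hB⟩ := hT ε hε δ hδ
  exact ⟨A + B, fun p => by rw [act_add, hA, hB, map_add]⟩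

theorem foldable_zero : Foldable fun _ : (Mat N)[X] => 0 :=
  fun _ _ _ _ => ⟨0, fun p => by rw [act_zero, map_zero]⟩

/-- Multiplication of 2 × 2 block matrices, the blocks being indexed by input and output parity. -/
theorem foldable_comp {S T : (Mat N)[X] → (Mat N)[X]} (hS : Foldable S) (hT : Foldable T)
    (hadd : ∀ p q, T (p + q) = T p + T q) : Foldable fun p => T (S p) := by
  intro ε hε δ hδ
  obtain ⟨A₀, hA₀⟩ := hS ε hε 0 (by norm_num)
  obtain ⟨A₁, hA₁⟩ := hS ε hε 1 (by norm_num)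
  obtain ⟨B₀, hB₀⟩ := hT 0 (by norm_num) δ hδ
  obtain ⟨B₁, hB₁⟩ := hT 1 (by norm_num) δ hδ
  refine ⟨A₀.comp B₀ + A₁.comp B₁, fun p => ?_⟩
  rw [act_add, act_comp, act_comp, hA₀, hA₁, hB₀, hB₁, ← map_add, ← hadd, unfoldPoly_fold_add]

/-- Foldability of an additive map can be checked on monomials. -/
theorem foldable_of_monomial {T : (Mat N)[X] → (Mat N)[X]}
    (hadd : ∀ p q, T (p + q) = T p + T q)
    (h : ∀ ε < 2, ∀ δ < 2, ∃ D : DiffOp N, ∀ k a,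
      act D (monomial k a) = foldPoly δ (T (monomial (2 * k + ε) a))) : Foldable T := by
  intro ε hε δ hδ
  obtain ⟨D, hD⟩ := h ε hε δ hδ
  refine ⟨D, fun p => ?_⟩
  induction p using Polynomial.induction_on' with
  | add p q hp hq => rw [act_polynomial_add, hp, hq, map_add, hadd, map_add]
  | monomial n a => rw [hD, unfoldPoly_monomial]

/-- The derivative exchanges parities: `p(x²)' = x · 2p'(x²)` and `(x p(x²))' = p(x²) + 2x² p'(x²)`.
The off-diagonal blocks are therefore `2 d/dy` and `1 + 2y d/dy`, where polynomial coefficients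
factor to the right. -/
theorem foldable_derivative : Foldable fun p : (Mat N)[X] => derivative p := by
  refine foldable_of_monomial (fun _ _ => derivative_add) fun ε hε δ hδ => ?_
  by_cases hεδ : ε = δ
  · refine ⟨0, fun k a => ?_⟩
    rw [act_zero, derivative_monomial, foldPoly_monomial]
    split_ifs
    -- Truncated subtraction keeps the parity of the exponent only for a constant, whose derivative
    -- vanishes.
    · have : ε = 0 ∧ k = 0 := by omega
      simp [this.1, this.2]
    · rfl
  · rcases (show ε = 0 ∧ δ = 1 ∨ ε = 1 ∧ δ = 0 by omega) with ⟨rfl, rfl⟩ | ⟨rfl, rfl⟩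
    · refine ⟨Finsupp.single 1 2, fun k a => ?_⟩
      rw [act_single, Function.iterate_one, derivative_monomial, derivative_monomial,
        foldPoly_monomial]
      rcases k with _ | k
      · simp
      · rw [if_pos (by omega), mul_two, ← map_add]
        rw [show (2 * (k + 1) + 0 - 1) / 2 = k + 1 - 1 by omega]
        congr 1
        push_cast
        simp only [mul_add, mul_one, two_mul, mul_two, add_zero]
        abel
    · refine ⟨Finsupp.single 0 1 + Finsupp.single 1 (2 * X), fun k a => ?_⟩
      rw [act_add, act_single, act_single, Function.iterate_one, Function.iterate_zero, id,
        derivative_monomial, derivative_monomial, foldPoly_monomial, if_pos (by omega), mul_one]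
      rcases k with _ | k
      · simp
      · rw [← mul_assoc, mul_two, ← map_add, monomial_mul_X, show k + 1 - 1 + 1 = k + 1 by rfl,
          ← map_add]
        rw [show (2 * (k + 1) + 1 - 1) / 2 = k + 1 by omega]
        congr 1
        push_cast
        simp only [mul_add, mul_one, two_mul, mul_two]
        abel

theorem foldable_mul_X : Foldable fun p : (Mat N)[X] => p * X := by
  refine foldable_of_monomial (fun _ _ => add_mul _ _ _) fun ε hε δ hδ => ?_
  by_cases hεδ : ε = δ
  · refine ⟨0, fun k a => ?_⟩
    rw [act_zero, monomial_mul_X, foldPoly_monomial, if_neg (by omega)]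
  · rcases (show ε = 0 ∧ δ = 1 ∨ ε = 1 ∧ δ = 0 by omega) with ⟨rfl, rfl⟩ | ⟨rfl, rfl⟩
    · refine ⟨Finsupp.single 0 1, fun k a => ?_⟩
      rw [act_single, monomial_mul_X, foldPoly_monomial, if_pos (by omega), mul_one,
        Function.iterate_zero, id]
      congr 2
      omega
    · refine ⟨Finsupp.single 0 X, fun k a => ?_⟩
      rw [act_single, monomial_mul_X, foldPoly_monomial, if_pos (by omega),
        Function.iterate_zero, id, monomial_mul_X]
      congr 2
      omega

theorem foldable_mul_C (b : Mat N) : Foldable fun p : (Mat N)[X] => p * C b := by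
  refine foldable_of_monomial (fun _ _ => add_mul _ _ _) fun ε hε δ hδ => ?_
  by_cases hεδ : ε = δ
  · refine ⟨Finsupp.single 0 (C b), fun k a => ?_⟩
    rw [act_single, monomial_mul_C, foldPoly_monomial, if_pos (by omega),
      Function.iterate_zero, id, monomial_mul_C]
    congr 2
    omega
  · refine ⟨0, fun k a => ?_⟩
    rw [act_zero, monomial_mul_C, foldPoly_monomial, if_neg (by omega)]

theorem foldable_mul (F : (Mat N)[X]) : Foldable fun p : (Mat N)[X] => p * F := by
  induction F using Polynomial.induction_on with
  | C a => exact foldable_mul_C a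
  | add F G hF hG => simpa only [mul_add] using foldable_add hF hG
  | monomial n a h =>
    have := foldable_comp h foldable_mul_X fun _ _ => add_mul _ _ _
    simpa only [mul_assoc, pow_succ] using this

theorem foldable_iterate_derivative_mul (j : ℕ) (F : (Mat N)[X]) :
    Foldable fun p : (Mat N)[X] => derivative^[j] p * F := by
  induction j with
  | zero => exact foldable_mul F
  | succ j ih =>
    exact foldable_comp foldable_derivative ih fun p q => by
      rw [iterate_map_add derivative, add_mul]

theorem foldable_act (D : DiffOp N) : Foldable (act D) := by
  induction D using Finsupp.induction_linear with
  | zero =>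
    have : act (0 : DiffOp N) = fun _ => 0 := funext act_zero
    rw [this]
    exact foldable_zero
  | add D E hD hE =>
    have : act (D + E) = fun p => act D p + act E p := funext (act_add D E)
    rw [this]
    exact foldable_add hD hE
  | single j F =>
    have : act (Finsupp.single j F) = fun p => derivative^[j] p * F := funext (act_single j F)
    rw [this]
    exact foldable_iterate_derivative_mul j F

/-! ### Parity-preserving operators and their descent -/

/-- `D` maps polynomials of either parity to polynomials of the same parity. -/
def ParityPreserving (D : DiffOp N) : Prop :=
  ∀ n, ∀ p ∈ parityPoly N n, act D p ∈ parityPoly N n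

/-- The `P n` form a basis over the matrices adapted to parity: subtracting the leading coefficient
times `P d` lowers the degree without changing the parity. -/
theorem ParityPreserving.of_monic {D : DiffOp N} {P : ℕ → (Mat N)[X]}
    (hmonic : ∀ n, (P n).Monic) (hdeg : ∀ n, (P n).degree = n)
    (hP : ∀ n, P n ∈ parityPoly N n) (hD : ∀ n, act D (P n) ∈ parityPoly N n) :
    D.ParityPreserving := by
  have key : ∀ d n (p : (Mat N)[X]), p.degree < (d : ℕ) → p ∈ parityPoly N n →
      act D p ∈ parityPoly N n := by
    intro d
    induction d with
    | zero =>
      intro n p hp _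
      have : p = 0 := by
        rw [← degree_eq_bot]
        exact Nat.WithBot.lt_zero_iff.1 (by simpa using hp)
      rw [this, act_polynomial_zero]
      exact Submodule.zero_mem _
    | succ d ih =>
      intro n p hdegp hp
      by_cases hd : Odd (d + n)
      · refine ih n p ?_ hp
        rw [degree_lt_iff_coeff_zero] at hdegp ⊢
        intro m hm
        rcases hm.eq_or_lt with rfl | hm
        · exact hp _ hd
        · exact hdegp m hm
      · have hpar : parityPoly N d = parityPoly N n :=
          parityPoly_congr (Nat.not_odd_iff_even.1 hd)
        have hsub : p - C (p.coeff d) * P d ∈ parityPoly N n :=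
          Submodule.sub_mem _ hp (C_mul_mem_parityPoly _ (hpar ▸ hP d))
        have hlt : (p - C (p.coeff d) * P d).degree < (d : ℕ) := by
          rw [degree_lt_iff_coeff_zero] at hdegp ⊢
          intro m hm
          rw [coeff_sub, coeff_C_mul]
          rcases hm.eq_or_lt with rfl | hm
          · have : (P d).coeff d = 1 := by
              have := hmonic d
              rwa [Monic, leadingCoeff, natDegree_eq_of_degree_eq_some (hdeg d)] at this
            rw [this, mul_one, sub_self]
          · rw [hdegp m hm, coeff_eq_zero_of_degree_lt (p := P d), mul_zero, sub_zero]
            rw [hdeg]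
            exact_mod_cast hm
        have := Submodule.add_mem _ (ih n _ hlt hsub)
          (C_mul_mem_parityPoly (p.coeff d) (hpar ▸ hD d))
        rwa [← act_C_mul, ← act_polynomial_add, sub_add_cancel] at this
  intro n p hp
  refine key (p.natDegree + 1) n p ?_ hp
  exact lt_of_le_of_lt degree_le_natDegree (by exact_mod_cast Nat.lt_succ_self _)

/-- A parity-preserving operator descends to a differential operator in `y = x²`. -/
theorem ParityPreserving.exists_descent {D : DiffOp N} (hD : D.ParityPreserving) {ε : ℕ}
    (hε : ε < 2) : ∃ E : DiffOp N, ∀ p, unfoldPoly ε (act E p) = act D (unfoldPoly ε p) := by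
  obtain ⟨E, hE⟩ := foldable_act D ε hε ε hε
  exact ⟨E, fun p => by
    rw [hE, unfoldPoly_foldPoly hε (hD ε _ (unfoldPoly_mem_parityPoly hε p))]⟩

theorem DegreePreserving.descent {D E : DiffOp N} (hD : D.DegreePreserving) {ε : ℕ} (hε : ε < 2)
    (hE : ∀ p, unfoldPoly ε (act E p) = act D (unfoldPoly ε p)) : E.DegreePreserving := by
  intro p
  apply degree_eq_of_degree_unfoldPoly_eq hε
  rw [hE, hD]

/-- A degree-preserving operator has invertible leading coefficients. -/
theorem DegreePreserving.exists_left_inverse {D : DiffOp N} (hD : D.DegreePreserving)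
    {P Q : (Mat N)[X]} (hP : P.Monic) {A : Mat N} (hA : act D P = C A * Q) :
    ∃ B : Mat N, B * A = 1 := by
  -- If `M A = 0`, then `D` kills `M P`, so `M P = 0` by preservation of degree, and `M = 0` since
  -- `P` is monic. An injective endomorphism of the finite-dimensional space of matrices is onto.
  have hinj : Function.Injective (LinearMap.mulRight ℂ A) := by
    rw [← LinearMap.ker_eq_bot, LinearMap.ker_eq_bot']
    intro M hM
    rw [LinearMap.mulRight_apply] at hM
    have h := hD (C M * P)
    rw [act_C_mul, hA, ← mul_assoc, ← C_mul, hM, C_0, zero_mul, degree_zero] at h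
    have h2 := degree_eq_bot.1 h.symm
    have h3 : (C M * P).coeff P.natDegree = M := by
      rw [coeff_C_mul, hP.coeff_natDegree, mul_one]
    rw [← h3, h2, coeff_zero]
  exact LinearMap.surjective_of_injective hinj 1

end DiffOp

/-! ### The matrix-valued form and the parity of orthogonal polynomials -/

theorem evalAt_add (p q : (Mat N)[X]) (x : ℝ) : evalAt (p + q) x = evalAt p x + evalAt q x :=
  Polynomial.sum_add_index p q _ (by simp) (by simp)

theorem evalAt_monomial (k : ℕ) (a : Mat N) (x : ℝ) :
    evalAt (monomial k a) x = (x : ℂ) ^ k • a :=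
  Polynomial.sum_monomial_index _ _ (by simp)

theorem evalAt_C_mul (a : Mat N) (p : (Mat N)[X]) (x : ℝ) :
    evalAt (C a * p) x = a * evalAt p x := by
  induction p using Polynomial.induction_on' with
  | add p q hp hq => rw [mul_add, evalAt_add, evalAt_add, hp, hq, mul_add]
  | monomial n b => rw [C_mul_monomial, evalAt_monomial, evalAt_monomial, mul_smul_comm]

theorem evalAt_unfoldPoly (ε : ℕ) (p : (Mat N)[X]) (x : ℝ) :
    evalAt (unfoldPoly ε p) x = (x : ℂ) ^ ε • evalAt p (x ^ 2) := by
  induction p using Polynomial.induction_on' with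
  | add p q hp hq => rw [map_add, evalAt_add, evalAt_add, hp, hq, smul_add]
  | monomial n b =>
    rw [unfoldPoly_monomial, evalAt_monomial, evalAt_monomial, smul_smul]
    push_cast
    ring_nf

theorem evalAt_neg {n : ℕ} {p : (Mat N)[X]} (hp : p ∈ parityPoly N n) (x : ℝ) :
    evalAt p (-x) = (-1 : ℂ) ^ n • evalAt p x := by
  simp only [evalAt, Polynomial.sum, Finset.smul_sum, smul_smul]
  refine Finset.sum_congr rfl fun k hk => ?_
  have h : Even (k + n) := by
    by_contra h
    exact (mem_support_iff.1 hk) (hp k (Nat.not_even_iff_odd.1 h))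
  have h2 : (-1 : ℂ) ^ k = (-1) ^ n := by
    rcases Nat.even_or_odd n with hn | hn
    · rw [hn.neg_one_pow, Even.neg_one_pow (by grind)]
    · rw [hn.neg_one_pow, Odd.neg_one_pow (by grind)]
  push_cast
  rw [neg_pow, h2]

/-- The matrix entries of a matrix polynomial. -/
noncomputable def entryPoly (p : (Mat N)[X]) (i j : Fin N) : ℂ[X] :=
  p.sum fun k a => monomial k (a i j)

theorem coeff_entryPoly (p : (Mat N)[X]) (i j : Fin N) (k : ℕ) :
    (entryPoly p i j).coeff k = p.coeff k i j := by
  rw [entryPoly, Polynomial.sum, finsetSum_coeff]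
  simp only [coeff_monomial]
  rw [Finset.sum_ite_eq' p.support k]
  split_ifs with h
  · rfl
  · rw [notMem_support_iff.1 h]
    rfl

theorem eval_entryPoly (p : (Mat N)[X]) (i j : Fin N) (x : ℝ) :
    (entryPoly p i j).eval (x : ℂ) = evalAt p x i j := by
  rw [entryPoly, Polynomial.sum, eval_finsetSum, evalAt, Polynomial.sum, Matrix.sum_apply]
  refine Finset.sum_congr rfl fun k _ => ?_
  rw [eval_monomial, Matrix.smul_apply, smul_eq_mul, mul_comm]

/-- A nonzero entry would have finitely many roots, making the zero set both null and conull. -/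
theorem eq_zero_of_ae_evalAt_eq_zero {p : (Mat N)[X]} (h : ∀ᵐ x : ℝ, evalAt p x = 0) :
    p = 0 := by
  ext1 k
  ext i j
  rw [← coeff_entryPoly]
  suffices entryPoly p i j = 0 by rw [this]; rfl
  refine eq_zero_of_infinite_isRoot _ fun hfin => ?_
  have hsub : {x : ℝ | evalAt p x = 0} ⊆ (fun x : ℝ => (x : ℂ)) ⁻¹'
      {z | IsRoot (entryPoly p i j) z} := by
    intro x hx
    have hx : evalAt p x = 0 := hx
    simp only [Set.mem_preimage, Set.mem_ofPred_eq, IsRoot, eval_entryPoly, hx, Matrix.zero_apply]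
  have hfin2 : {x : ℝ | evalAt p x = 0}.Finite :=
    (hfin.preimage Complex.ofReal_injective.injOn).subset hsub
  have h1 : volume {x : ℝ | evalAt p x = 0} = 0 := hfin2.measure_zero _
  have h2 : volume {x : ℝ | evalAt p x = 0}ᶜ = 0 := h
  have h3 : (volume : Measure ℝ) Set.univ = 0 := by
    rw [← Set.union_compl_self {x : ℝ | evalAt p x = 0}]
    exact measure_union_null h1 h2
  simp at h3

theorem IsWeight.integrableOn_eval_mul {I : Set ℝ} {W : ℝ → Mat N} (hW : IsWeight I W) (p : ℂ[X])
    (i j : Fin N) : IntegrableOn (fun x : ℝ => p.eval (x : ℂ) * W x i j) I := by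
  simp only [eval_eq_sum_range, Finset.sum_mul, mul_assoc]
  exact integrable_finsetSum _ fun k _ => (hW.moments k i j).const_mul _

theorem conj_eval (p : ℂ[X]) (x : ℝ) :
    star (p.eval (x : ℂ)) = (p.map (starRingEnd ℂ)).eval (x : ℂ) := by
  have := Polynomial.eval_map_apply (f := starRingEnd ℂ) (p := p) (x : ℂ)
  rw [Complex.conj_ofReal] at this
  exact this.symm

theorem IsWeight.integrableOn_form {I : Set ℝ} {W : ℝ → Mat N} (hW : IsWeight I W)
    (p q : (Mat N)[X]) (i j : Fin N) :
    IntegrableOn (fun x => (evalAt p x * W x * (evalAt q x).conjTranspose) i j) I := by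
  simp only [Matrix.mul_apply, Finset.sum_mul, Matrix.conjTranspose_apply, ← eval_entryPoly,
    conj_eval]
  refine integrable_finsetSum _ fun b _ => integrable_finsetSum _ fun a _ => ?_
  have := hW.integrableOn_eval_mul (entryPoly p i a * (entryPoly q j b).map (starRingEnd ℂ)) a b
  refine this.congr (Filter.Eventually.of_forall fun x => ?_)
  simp only [eval_mul]
  ring

theorem form_add_left {I : Set ℝ} {W : ℝ → Mat N} (hW : IsWeight I W) (p q r : (Mat N)[X]) :
    form I W (p + q) r = form I W p r + form I W q r := by
  ext i j
  simp only [form, Matrix.of_apply, Matrix.add_apply, evalAt_add, add_mul]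
  exact integral_add (hW.integrableOn_form p r i j) (hW.integrableOn_form q r i j)

theorem form_add_right {I : Set ℝ} {W : ℝ → Mat N} (hW : IsWeight I W) (p q r : (Mat N)[X]) :
    form I W p (q + r) = form I W p q + form I W p r := by
  ext i j
  simp only [form, Matrix.of_apply, Matrix.add_apply, evalAt_add, mul_add,
    Matrix.conjTranspose_add]
  exact integral_add (hW.integrableOn_form p q i j) (hW.integrableOn_form p r i j)

theorem form_zero_right (I : Set ℝ) (W : ℝ → Mat N) (p : (Mat N)[X]) : form I W p 0 = 0 := by
  ext i j
  simp [form, evalAt]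

theorem form_C_mul_right {I : Set ℝ} {W : ℝ → Mat N} (hW : IsWeight I W) (p q : (Mat N)[X])
    (a : Mat N) : form I W p (C a * q) = form I W p q * a.conjTranspose := by
  ext i j
  rw [Matrix.mul_apply]
  simp only [form, Matrix.of_apply, evalAt_C_mul, Matrix.conjTranspose_mul]
  simp only [← mul_assoc]
  simp only [Matrix.mul_apply (N := a.conjTranspose), ← integral_mul_const]
  exact integral_finsetSum _ fun k _ => (hW.integrableOn_form p q i k).mul_const _

/-- The form of a weight on the real line is definite. -/
theorem eq_zero_of_form_self_eq_zero {W : ℝ → Mat N} (hW : IsWeight Set.univ W) {p : (Mat N)[X]}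
    (h : form Set.univ W p p = 0) : p = 0 := by
  apply eq_zero_of_ae_evalAt_eq_zero
  have hpos : ∀ᵐ x : ℝ, (W x).PosDef := by simpa using hW.posDef
  have hentry : ∀ i : Fin N, ∀ᵐ x : ℝ, (evalAt p x * W x * (evalAt p x).conjTranspose) i i = 0 := by
    intro i
    have hint : Integrable
        (fun x => (evalAt p x * W x * (evalAt p x).conjTranspose) i i) := by
      simpa using hW.integrableOn_form p p i i
    have hnn : ∀ᵐ x : ℝ, 0 ≤ (evalAt p x * W x * (evalAt p x).conjTranspose) i i := by
      filter_upwards [hpos] with x hx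
      exact (hx.posSemidef.mul_mul_conjTranspose_same _).diag_nonneg
    have h0 : ∫ x : ℝ, (evalAt p x * W x * (evalAt p x).conjTranspose) i i = 0 := by
      have := congrFun (congrFun h i) i
      simpa [form] using this
    have hre : ∫ x : ℝ, ((evalAt p x * W x * (evalAt p x).conjTranspose) i i).re = 0 := by
      have := integral_re hint
      simp only [RCLike.re_to_complex] at this
      rw [this, h0, Complex.zero_re]
    rw [integral_eq_zero_iff_of_nonneg_ae
      (hnn.mono fun x hx => (Complex.nonneg_iff.1 hx).1) hint.re] at hre
    filter_upwards [hre, hnn] with x hx hx'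
    exact Complex.ext hx (Complex.nonneg_iff.1 hx').2.symm
  filter_upwards [hpos, ae_all_iff.2 hentry] with x hx hx0
  by_contra hne
  obtain ⟨i, hi⟩ : ∃ i, evalAt p x i ≠ 0 := by
    by_contra hcon
    push Not at hcon
    exact hne (funext hcon)
  -- With `v` a nonzero row of `p(x)`, the diagonal entry `v W(x) v*` is positive, yet it vanishes.
  have := hx.dotProduct_mulVec_pos (x := star (evalAt p x i)) (by simpa using hi)
  rw [star_star] at this
  refine this.ne' ?_
  rw [← hx0 i, mul_assoc]
  rfl

theorem IsMonicOPS.form_eq_zero_of_degree_lt {I : Set ℝ} {W : ℝ → Mat N} (hW : IsWeight I W)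
    {P : ℕ → (Mat N)[X]} (hP : IsMonicOPS I W P) (n : ℕ) (q : (Mat N)[X])
    (hq : q.degree < (n : ℕ)) : form I W (P n) q = 0 := by
  have key : ∀ k ≤ n, ∀ q : (Mat N)[X], q.degree < (k : ℕ) → form I W (P n) q = 0 := by
    intro k
    induction k with
    | zero =>
      intro _ q hq
      have : q = 0 := by
        rw [← degree_eq_bot]
        exact Nat.WithBot.lt_zero_iff.1 (by simpa using hq)
      rw [this, form_zero_right]
    | succ k ih =>
      intro hk q hq
      have hlt : (q - C (q.coeff k) * P k).degree < (k : ℕ) := by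
        rw [degree_lt_iff_coeff_zero] at hq ⊢
        intro m hm
        rw [coeff_sub, coeff_C_mul]
        rcases hm.eq_or_lt with rfl | hm
        · have : (P k).coeff k = 1 := by
            have := hP.monic k
            rwa [Monic, leadingCoeff, natDegree_eq_of_degree_eq_some (hP.degree_eq k)] at this
          rw [this, mul_one, sub_self]
        · rw [hq m hm, coeff_eq_zero_of_degree_lt (p := P k), mul_zero, sub_zero]
          rw [hP.degree_eq]
          exact_mod_cast hm
      rw [← sub_add_cancel q (C (q.coeff k) * P k), form_add_right hW,
        ih (by omega) _ hlt, form_C_mul_right hW, hP.orthogonal n k (by omega), zero_mul, add_zero]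
  exact key n le_rfl q hq

/-- The integrand is odd. -/
theorem form_eq_zero_of_parity {W : ℝ → Mat N} (hsymm : ∀ x, W (-x) = W x) {n : ℕ}
    {p q : (Mat N)[X]} (hp : p ∈ parityPoly N n) (hq : q ∈ parityPoly N (n + 1)) :
    form Set.univ W p q = 0 := by
  ext i j
  simp only [form, Matrix.of_apply, Measure.restrict_univ, Matrix.zero_apply]
  have h : ∀ x : ℝ, (evalAt p (-x) * W (-x) * (evalAt q (-x)).conjTranspose) i j =
      -(evalAt p x * W x * (evalAt q x).conjTranspose) i j := by
    intro x
    rw [evalAt_neg hp, evalAt_neg hq, hsymm, Matrix.conjTranspose_smul]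
    simp only [smul_mul_assoc, mul_smul_comm, Matrix.smul_apply, smul_eq_mul]
    rcases neg_one_pow_eq_or ℂ n with h | h <;> simp [pow_succ, h]
  have h1 := integral_neg_eq_self
    (fun x : ℝ => (evalAt p x * W x * (evalAt q x).conjTranspose) i j) volume
  simp only [h, integral_neg] at h1
  exact self_eq_neg.1 h1.symm

/-- The monic orthogonal polynomials of an even weight have parity `(-1)ⁿ`. -/
theorem IsMonicOPS.mem_parityPoly {W : ℝ → Mat N} (hW : IsWeight Set.univ W)
    (hsymm : ∀ x, W (-x) = W x) {P : ℕ → (Mat N)[X]} (hP : IsMonicOPS Set.univ W P) (n : ℕ) :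
    P n ∈ parityPoly N n := by
  obtain ⟨q, hq, r, hr, h⟩ := exists_parity_decomposition n (P n)
  -- The part `r` of wrong parity has no term in `xⁿ`, and above `n` it inherits the zero
  -- coefficients of `P n`. So `⟨q + r, r⟩ = 0`; as `⟨q, r⟩ = 0` by parity, `⟨r, r⟩ = 0`.
  have hdeg : r.degree < (n : ℕ) := by
    rw [degree_lt_iff_coeff_zero]
    intro m hm
    rcases Nat.even_or_odd (m + n) with hmn | hmn
    · exact hr m (by grind)
    · have h1 : (P n).coeff m = 0 := by
        apply coeff_eq_zero_of_degree_lt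
        rw [hP.degree_eq]
        have : m ≠ n := by rintro rfl; grind
        exact_mod_cast lt_of_le_of_ne hm this.symm
      rwa [← h, coeff_add, hq m hmn, zero_add] at h1
  have h1 := hP.form_eq_zero_of_degree_lt hW n r hdeg
  rw [← h, form_add_left hW, form_eq_zero_of_parity hsymm hq hr, zero_add] at h1
  rw [← h, eq_zero_of_form_self_eq_zero hW h1, add_zero]
  exact hq

/-! ### Folding an even weight -/

/-- `V(y) = y^{ε - 1/2} W(√y)` for `y > 0`, expressed in the variable `x = √y`. -/
def IsFoldedWeight (ε : ℕ) (W V : ℝ → Mat N) : Prop :=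
  ∀ x : ℝ, 0 < x → (x : ℂ) • V (x ^ 2) = (x : ℂ) ^ (2 * ε) • W x

theorem isFoldedWeight_laguerreWeight (Z : ℝ → Mat N) (ε : ℕ) :
    IsFoldedWeight ε (hermiteWeight Z) (laguerreWeight (ε - 1 / 2) fun y => Z √y) := by
  intro x hx
  have h : x * (x ^ 2) ^ ((ε : ℝ) - 1 / 2) = x ^ (2 * ε) := by
    rw [← Real.rpow_natCast, ← Real.rpow_natCast, ← Real.rpow_mul hx.le]
    nth_rewrite 1 [← Real.rpow_one x]
    rw [← Real.rpow_add hx]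
    congr 1
    push_cast
    ring
  rw [laguerreWeight, hermiteWeight, Real.sqrt_sq hx.le, smul_smul, smul_smul]
  congr 1
  rw [← Complex.ofReal_mul, ← mul_assoc, h]
  push_cast
  rfl

namespace IsFoldedWeight

variable {ε : ℕ} {W V : ℝ → Mat N}

theorem eq_smul (h : IsFoldedWeight ε W V) {x : ℝ} (hx : 0 < x) :
    V (x ^ 2) = ((x : ℂ)⁻¹ * (x : ℂ) ^ (2 * ε)) • W x := by
  rw [mul_smul, ← h x hx, inv_smul_smul₀ (by exact_mod_cast hx.ne')]

/-- Squaring is differentiable, so it carries the null set where `W` fails to be positive definite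
to a null set; elsewhere `V` is a positive multiple of `W`. -/
theorem ae_posDef (h : IsFoldedWeight ε W V) (hW : IsWeight Set.univ W) :
    ∀ᵐ y ∂volume.restrict (Set.Ioi (0 : ℝ)), (V y).PosDef := by
  have hpos : ∀ᵐ x : ℝ, (W x).PosDef := by simpa using hW.posDef
  have hnull : volume ((fun x : ℝ => x ^ 2) '' {x | ¬ (W x).PosDef}) = 0 :=
    addHaar_image_eq_zero_of_differentiableOn_of_addHaar_eq_zero volume
      (by fun_prop) hpos
  rw [ae_restrict_iff' measurableSet_Ioi]
  refine measure_mono_null (fun y hy => ?_) hnull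
  have hy : ¬ (0 < y → (V y).PosDef) := hy
  push Not at hy
  have hs : 0 < √y := Real.sqrt_pos.2 hy.1
  have hsq : √y ^ 2 = y := Real.sq_sqrt hy.1.le
  refine ⟨√y, fun hWy => hy.2 ?_, hsq⟩
  have := h.eq_smul hs
  rw [hsq] at this
  rw [this]
  refine hWy.smul ?_
  have : (0 : ℂ) < (√y : ℝ) := by exact_mod_cast hs
  exact_mod_cast (by positivity : 0 < (√y)⁻¹ * √y ^ (2 * ε))

theorem isWeight (h : IsFoldedWeight ε W V) (hW : IsWeight Set.univ W) :
    IsWeight (Set.Ioi 0) V where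
  ordConnected := Set.ordConnected_Ioi
  interior_nonempty := by
    rw [interior_Ioi]
    exact Set.nonempty_Ioi
  posDef := h.ae_posDef hW
  moments n i j := by
    -- Under `y = x²`, `dy = 2x dx`, the moment of order `n` of `V` becomes twice that of order `2n
    -- + 2ε` of `W` over the half-line.
    rw [← integrableOn_Ioi_comp_rpow_iff _ (two_ne_zero (α := ℝ))]
    have hint := ((hW.moments (2 * n + 2 * ε) i j).mono_set
      (Set.subset_univ (Set.Ioi 0))).const_mul 2
    refine IntegrableOn.congr_fun hint (fun x hx => ?_) measurableSet_Ioi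
    have hx : 0 < x := hx
    have hV : (x : ℂ) * V (x ^ 2) i j = (x : ℂ) ^ (2 * ε) * W x i j :=
      congrFun (congrFun (h x hx) i) j
    norm_num
    rw [pow_add, mul_assoc ((x : ℂ) ^ (2 * n)), ← hV, pow_mul]
    ring

/-- The factor 2 in `dy = 2x dx` is absorbed by evenness of the integrand on the line, so the
identity holds without a constant. -/
theorem form_eq (h : IsFoldedWeight ε W V) (hW : IsWeight Set.univ W)
    (hsymm : ∀ x, W (-x) = W x) (hε : ε < 2) (p q : (Mat N)[X]) :
    form (Set.Ioi 0) V p q = form Set.univ W (unfoldPoly ε p) (unfoldPoly ε q) := by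
  ext i j
  simp only [form, Matrix.of_apply, Measure.restrict_univ]
  set f : ℝ → ℂ := fun x => (evalAt (unfoldPoly ε p) x * W x *
    (evalAt (unfoldPoly ε q) x).conjTranspose) i j with hf
  have hint : Integrable f := by
    simpa using hW.integrableOn_form (unfoldPoly ε p) (unfoldPoly ε q) i j
  have heven : ∀ x, f (-x) = f x := by
    intro x
    simp only [hf]
    rw [evalAt_neg (unfoldPoly_mem_parityPoly hε p), evalAt_neg (unfoldPoly_mem_parityPoly hε q),
      hsymm, Matrix.conjTranspose_smul]
    simp only [smul_mul_assoc, mul_smul_comm, Matrix.smul_apply, smul_eq_mul]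
    rcases neg_one_pow_eq_or ℂ ε with h | h <;> simp [h]
  have hhalf : ∫ x, f x = ∫ x in Set.Ioi 0, (f x + f x) := by
    have h1 := integral_comp_neg_Ioi 0 f
    simp only [heven, neg_zero] at h1
    rw [← intervalIntegral.integral_Iic_add_Ioi (b := 0) hint.integrableOn hint.integrableOn, ← h1,
      integral_add hint.integrableOn hint.integrableOn]
  rw [hhalf, ← integral_comp_rpow_Ioi_of_pos (two_pos (α := ℝ))]
  refine setIntegral_congr_fun measurableSet_Ioi fun x hx => ?_
  have hx : 0 < x := hx
  have hV : (x : ℂ) • (evalAt p (x ^ 2) * V (x ^ 2) * (evalAt q (x ^ 2)).conjTranspose) =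
      evalAt (unfoldPoly ε p) x * W x * (evalAt (unfoldPoly ε q) x).conjTranspose := by
    rw [← smul_mul_assoc, ← mul_smul_comm, h x hx, evalAt_unfoldPoly, evalAt_unfoldPoly,
      Matrix.conjTranspose_smul]
    simp only [smul_mul_assoc, mul_smul_comm, smul_smul]
    congr 1
    simp only [star_pow, RCLike.star_def, Complex.conj_ofReal]
    ring
  have hV' := congrFun (congrFun hV i) j
  rw [Matrix.smul_apply, smul_eq_mul] at hV'
  simp only [hf, ← hV']
  norm_num
  ring

theorem isMonicOPS (h : IsFoldedWeight ε W V) (hW : IsWeight Set.univ W)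
    (hsymm : ∀ x, W (-x) = W x) (hε : ε < 2) {P : ℕ → (Mat N)[X]}
    (hP : IsMonicOPS Set.univ W P) :
    IsMonicOPS (Set.Ioi 0) V fun n => foldPoly ε (P (2 * n + ε)) := by
  have hlead : ∀ n, (foldPoly ε (P (2 * n + ε))).coeff n = 1 := by
    intro n
    have := hP.monic (2 * n + ε)
    rwa [Monic, leadingCoeff, natDegree_eq_of_degree_eq_some (hP.degree_eq _),
      ← coeff_foldPoly hε] at this
  -- A polynomial of degree exactly 0 excludes `N = 0`, where leading coefficient 1 would say
  -- nothing about the degree.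
  have hone : (1 : Mat N) ≠ 0 := by
    intro h10
    have h0 := hP.degree_eq 0
    have : P 0 = 0 := by
      ext1 k
      rw [← mul_one ((P 0).coeff k), h10, mul_zero, coeff_zero]
    rw [this, degree_zero] at h0
    exact WithBot.bot_ne_coe h0
  have hdeg : ∀ n, (foldPoly ε (P (2 * n + ε))).degree = n := by
    intro n
    refine degree_eq_of_le_of_coeff_ne_zero ?_ (by rwa [hlead])
    rw [degree_le_iff_coeff_zero]
    intro m hm
    rw [coeff_foldPoly hε]
    apply coeff_eq_zero_of_degree_lt
    rw [hP.degree_eq]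
    have hm : n < m := by exact_mod_cast hm
    exact_mod_cast (by omega : 2 * n + ε < 2 * m + ε)
  have hparity : ∀ n, P (2 * n + ε) ∈ parityPoly N ε := fun n => by
    rw [← parityPoly_congr (m := 2 * n + ε) (by grind)]
    exact hP.mem_parityPoly hW hsymm _
  refine ⟨fun n => ?_, hdeg, fun m n hmn => ?_⟩
  · rw [Monic, leadingCoeff, natDegree_eq_of_degree_eq_some (hdeg n), hlead]
  · rw [h.form_eq hW hsymm hε, unfoldPoly_foldPoly hε (hparity m),
      unfoldPoly_foldPoly hε (hparity n)]
    exact hP.orthogonal _ _ (by omega)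

end IsFoldedWeight

/-! ### Descent of Darboux transformations -/

theorem act_foldPoly {ε : ℕ} (hε : ε < 2) {D E : DiffOp N}
    (hE : ∀ p, unfoldPoly ε (E.act p) = D.act (unfoldPoly ε p)) {p q : (Mat N)[X]} {A : Mat N}
    (hp : p ∈ parityPoly N ε) (h : D.act p = C A * q) :
    E.act (foldPoly ε p) = C A * foldPoly ε q := by
  rw [← foldPoly_unfoldPoly hε (E.act _), hE, unfoldPoly_foldPoly hε hp, h, ← smul_eq_C_mul,
    map_smul, smul_eq_C_mul]

/-- A Darboux transformation between even weights on the real line descends along `y = x²`. -/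
theorem IsDarbouxTransformation.fold {W W' V V' : ℝ → Mat N} {ε : ℕ} (hε : ε < 2)
    (hdar : IsDarbouxTransformation Set.univ W' Set.univ W)
    (hsymm : ∀ x, W (-x) = W x) (hsymm' : ∀ x, W' (-x) = W' x)
    (hV : IsFoldedWeight ε W V) (hV' : IsFoldedWeight ε W' V') :
    IsDarbouxTransformation (Set.Ioi 0) V' (Set.Ioi 0) V := by
  obtain ⟨hW, hW', P, P', hP, hP', D, ⟨Q, hQ, Λ, hΛ⟩, S, T, hST, hS, hT, A, hA⟩ := hdar
  have hPpar := hP.mem_parityPoly hW hsymm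
  have hP'par := hP'.mem_parityPoly hW' hsymm'
  have hQpar := hQ.mem_parityPoly hW hsymm
  have hSpar : S.ParityPreserving := .of_monic hP.monic hP.degree_eq hPpar fun n => by
    rw [hA]
    exact C_mul_mem_parityPoly _ (hP'par n)
  -- Membership in `𝒟(W)` brings its own sequence `Q`. Working with its parity directly avoids
  -- proving `Q = P`.
  have hDpar : D.ParityPreserving := .of_monic hQ.monic hQ.degree_eq hQpar fun n => by
    rw [hΛ]
    exact C_mul_mem_parityPoly _ (hQpar n)
  -- With `B A_n = 1`, `P'_n · T = B (P_n · S) · T = B (P_n · D)`, which has the parity of `n`.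
  have hTpar : T.ParityPreserving := .of_monic hP'.monic hP'.degree_eq hP'par fun n => by
    obtain ⟨B, hB⟩ := hS.exists_left_inverse (hP.monic n) (hA n)
    have h := C_mul_mem_parityPoly B (hDpar n _ (hPpar n))
    rwa [hST, DiffOp.act_comp, hA, DiffOp.act_C_mul, ← mul_assoc, ← C_mul, hB, C_1, one_mul] at h
  obtain ⟨S₁, hS₁⟩ := hSpar.exists_descent hε
  obtain ⟨T₁, hT₁⟩ := hTpar.exists_descent hε
  have hD₁ : ∀ p, unfoldPoly ε ((S₁.comp T₁).act p) = D.act (unfoldPoly ε p) := fun p => by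
    rw [hST, DiffOp.act_comp, DiffOp.act_comp, hT₁, hS₁]
  have hpar : ∀ n, parityPoly N (2 * n + ε) = parityPoly N ε := fun n =>
    parityPoly_congr (by grind)
  exact ⟨hV.isWeight hW, hV'.isWeight hW', _, _, hV.isMonicOPS hW hsymm hε hP,
    hV'.isMonicOPS hW' hsymm' hε hP', S₁.comp T₁,
    ⟨_, hV.isMonicOPS hW hsymm hε hQ, fun n => Λ (2 * n + ε),
      fun n => act_foldPoly hε hD₁ (hpar n ▸ hQpar _) (hΛ _)⟩,
    S₁, T₁, rfl, hS.descent hε hS₁, hT.descent hε hT₁, fun n => A (2 * n + ε),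
    fun n => act_foldPoly hε hS₁ (hpar n ▸ hPpar _) (hA _)⟩

end MVOP

theorem theorem5p3 {N : ℕ} (Z : ℝ → MVOP.Mat N)
    (hsymm : ∀ x : ℝ, MVOP.hermiteWeight Z x = MVOP.hermiteWeight Z (-x))
    (hDarboux : MVOP.IsDarbouxTransformation
      Set.univ (MVOP.hermiteWeight Z) Set.univ (MVOP.hermiteWeight fun _ => 1)) :
    MVOP.IsDarbouxTransformation
      (Set.Ioi 0) (MVOP.laguerreWeight (-1 / 2) fun y => Z (Real.sqrt y))
      (Set.Ioi 0) (MVOP.laguerreWeight (-1 / 2) fun _ => 1) ∧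
    MVOP.IsDarbouxTransformation
      (Set.Ioi 0) (MVOP.laguerreWeight (1 / 2) fun y => Z (Real.sqrt y))
      (Set.Ioi 0) (MVOP.laguerreWeight (1 / 2) fun _ => 1) := by
  have hone : ∀ x : ℝ, MVOP.hermiteWeight (fun _ => (1 : MVOP.Mat N)) (-x) =
      MVOP.hermiteWeight (fun _ => 1) x := fun x => by simp [MVOP.hermiteWeight]
  have key : ∀ ε < 2, MVOP.IsDarbouxTransformation
      (Set.Ioi 0) (MVOP.laguerreWeight ((ε : ℕ) - 1 / 2) fun y => Z (Real.sqrt y))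
      (Set.Ioi 0) (MVOP.laguerreWeight ((ε : ℕ) - 1 / 2) fun _ => 1) := fun ε hε =>
    hDarboux.fold hε hone (fun x => (hsymm x).symm)
      (MVOP.isFoldedWeight_laguerreWeight _ ε) (MVOP.isFoldedWeight_laguerreWeight Z ε)
  have h0 := key 0 (by norm_num)
  have h1 := key 1 (by norm_num)
  rw [show ((0 : ℕ) : ℝ) - 1 / 2 = -1 / 2 by norm_num] at h0
  rw [show ((1 : ℕ) : ℝ) - 1 / 2 = 1 / 2 by norm_num] at h1
  exact ⟨h0, h1⟩
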